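/- Let $\mathcal F$ be a finite signature, let $\mathcal V$ be a countably infinite set of variables, and let $\mathcal R$ be a finite set of rewrite rules $l\to r$ with $l,r\in\mathcal T(\mathcal F,\mathcal V)$ and $\mathrm{Var}(r)\subseteq \mathrm{Var}(l)$ (the left-hand side $l$ may be a variable). Assume that $\mathcal R$ is linear: in each rule, no variable occurs twice in $l$ and none occurs twice in $r$. Let $\to_{\mathcal R}$ be the rewriting relation on ground terms $\mathcal T(\mathcal F)$. Marked terms are terms over the symbols $f^i$ ($f\in\mathcal F$, $i\in\mathbb N$), where $i$ is the mark; $f^0$ is identified with $f$. For a marked term $\bar t$ and $n\in\mathbb N$ let $\bar t\odot n$ be obtained by replacing each mark $i$ by $\max(i,n)$. A marked step is $\bar C[\bar l\bar\sigma]\mathrel{\circ\!\!\to}\bar C[r\bar\sigma']$, where $\bar C$ is a marked context, $\bar l$ is a marked version of the left-hand side of a rule $l\to r$ of $\mathcal R$, the symbols of $r$ get the mark $0$, and $x\bar\sigma'=x\bar\sigma\odot(m_x+1)$ with $m_x$ the supremum of the marks of the nodes strictly above the occurrence of $x$ in $\bar C[\bar l]$ (and $\sup\emptyset=0$). The step is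 weakly bottom-up if the root of $\bar l$ has mark $0$ or, when $l$ is a variable, if all nodes of $\bar C$ strictly above its hole have mark $0$. For $s,t\in\mathcal T(\mathcal F)$ write $s\mathrel{{}_k\!\!\to^*_{\mathcal R}}t$ if there is a sequence of weakly bottom-up marked steps from $s$ (all marks $0$) to a marked version of $t$ such that all marks occurring in the sequence are at most $k$. The system $\mathcal R$ belongs to $\mathsf{BU}(k)$ if, for all $s,t\in\mathcal T(\mathcal F)$, $s\to^*_{\mathcal R}t$ implies $s\mathrel{{}_k\!\!\to^*_{\mathcal R}}t$, and to $\mathsf{BU}$ if it belongs to $\mathsf{BU}(k)$ for some $k\ge 0$. For a relation $\rho$ on $\mathcal T(\mathcal F)$ and $T\subseteq\mathcal T(\mathcal F)$ let $(\rho)[T]=\{s\in\mathcal T(\mathcal F): \exists t\in T,\ s\mathrel{\rho}t\}$. A set $T\subseteq\mathcal T(\mathcal F)$ is recognizable if it is the language of a finite (bottom-up, possibly nondeterministic) tree automaton. Then: 1. If $\mathcal R$ belongs to $\mathsf{BU}$, then $\mathcal R$ is inverse-recognizability preserving: for every recognizable $T\subseteq\mathcal T(\mathcal F)$, the set $(\to^*_{\mathcal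 R})[T]$ is recognizable. 2. If $\mathcal R$ belongs to $\mathsf{BU}(k)$, then $(\to^*_{\mathcal R})[T]=({}_k\!\!\to^*_{\mathcal R})[T]$ for every $T\subseteq\mathcal T(\mathcal F)$, and $({}_k\!\!\to^*_{\mathcal R})[T]$ is recognizable for every recognizable $T\subseteq\mathcal T(\mathcal F)$. -/

import Mathlib

namespace BottomUp

universe u v

/-! Terms over a signature are Mathlib's first-order terms: a signature is the family
`L.Functions` of function symbols indexed by arity (the relation symbols of `L` are never used),
`L.Term ℕ` are the terms with variables in `ℕ`, and `L.Term Empty` are the ground terms. -/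

section Terms

variable {L : FirstOrder.Language.{u, v}}

/-- Number of occurrences of the variable `x` in a term. -/
def occ (x : ℕ) : L.Term ℕ → ℕ
  | .var y => if y = x then 1 else 0
  | .func _ ts => ∑ i, occ x (ts i)

/-- A term is linear if no variable occurs twice in it. -/
def IsLinear (t : L.Term ℕ) : Prop := ∀ x, occ x t ≤ 1

variable (L) in
/-- One-hole contexts over the ground terms. In `app f ts i C` the hole lies in the `i`-th argument;
the value `ts i` is irrelevant, since `plug` overwrites it. -/
inductive Ctx : Type u
  | hole : Ctx
  | app {n : ℕ} (f : L.Functions n) (ts : Fin n → L.Term Empty) (i : Fin n) (C : Ctx) : Ctx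

/-- `C.plug t` is `C[t]`. -/
def Ctx.plug : Ctx L → L.Term Empty → L.Term Empty
  | .hole, t => t
  | .app f ts i C, t => .func f (Function.update ts i (C.plug t))

end Terms

section Rewriting

variable {L : FirstOrder.Language.{u, v}}

variable (L) in
/-- A rewrite rule `lhs → rhs` with `Var(rhs) ⊆ Var(lhs)`. The left-hand side may be a variable. -/
structure Rule where
  lhs : L.Term ℕ
  rhs : L.Term ℕ
  vars_subset : rhs.varFinset ⊆ lhs.varFinset

/-- A rewriting system is linear if both sides of each of its rules are linear. -/
def LinearSystem (R : Set (Rule L)) : Prop :=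
  ∀ ρ ∈ R, IsLinear ρ.lhs ∧ IsLinear ρ.rhs

/-- The one-step rewriting relation on ground terms. -/
def Step (R : Set (Rule L)) (s t : L.Term Empty) : Prop :=
  ∃ ρ ∈ R, ∃ (C : Ctx L) (σ : ℕ → L.Term Empty),
    s = C.plug (ρ.lhs.subst σ) ∧ t = C.plug (ρ.rhs.subst σ)

/-- The derivation relation `→*` on ground terms. -/
def Derives (R : Set (Rule L)) : L.Term Empty → L.Term Empty → Prop :=
  Relation.ReflTransGen (Step R)

/-- The set of ancestors of `T` for a binary relation on ground terms. -/
def ancestors (rel : L.Term Empty → L.Term Empty → Prop) (T : Set (L.Term Empty)) :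
    Set (L.Term Empty) :=
  {s | ∃ t ∈ T, rel s t}

end Rewriting

section Marking

/-- The signature of marked symbols: a function symbol together with a mark in `ℕ`. -/
def marked (L : FirstOrder.Language.{u, v}) : FirstOrder.Language.{u, v} where
  Functions n := L.Functions n × ℕ
  Relations := L.Relations

variable {L : FirstOrder.Language.{u, v}} {α : Type*}

/-- A symbol with a mark, as a symbol of the marked signature. -/
def withMark {n : ℕ} (f : L.Functions n) (j : ℕ) : (marked L).Functions n := (f, j)

/-- The mark of a marked symbol. -/
def symMark {n : ℕ} (f : (marked L).Functions n) : ℕ := f.2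

/-- The underlying symbol of a marked symbol. -/
def symBase {n : ℕ} (f : (marked L).Functions n) : L.Functions n := f.1

/-- Removal of all marks. -/
def unmark : (marked L).Term α → L.Term α
  | .var x => .var x
  | .func f ts => .func (symBase f) fun i => unmark (ts i)

/-- A term seen as a marked term, all marks being `0`. -/
def zeroMark : L.Term α → (marked L).Term α
  | .var x => .var x
  | .func f ts => .func (withMark f 0) fun i => zeroMark (ts i)

/-- The mark at the root of a marked term; it is `0` for a variable. -/
def rootMark : (marked L).Term α → ℕ
  | .var _ => 0
  | .func f _ => symMark f

/-- The maximal mark occurring in a marked term. -/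
def maxMark : (marked L).Term α → ℕ
  | .var _ => 0
  | .func f ts => max (symMark f) (Finset.univ.sup fun i => maxMark (ts i))

/-- `raise t j` replaces each mark `i` in `t` by `max i j`. -/
def raise : (marked L).Term α → ℕ → (marked L).Term α
  | .var x, _ => .var x
  | .func f ts, j => .func (withMark (symBase f) (max (symMark f) j)) fun i => raise (ts i) j

/-- `MarkAboveVar t x j`: some node of `t` strictly above an occurrence of `x` has the mark `j`. -/
inductive MarkAboveVar : (marked L).Term ℕ → ℕ → ℕ → Prop
  | root {n : ℕ} (f : (marked L).Functions n) (ts : Fin n → (marked L).Term ℕ) (i : Fin n) (x : ℕ) :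
      x ∈ (ts i).varFinset → MarkAboveVar (.func f ts) x (symMark f)
  | arg {n : ℕ} (f : (marked L).Functions n) (ts : Fin n → (marked L).Term ℕ) (i : Fin n)
      (x j : ℕ) : MarkAboveVar (ts i) x j → MarkAboveVar (.func f ts) x j

/-- The set of the marks of the nodes of a marked context that lie strictly above its hole. -/
def marksAboveHole : Ctx (marked L) → Set ℕ
  | .hole => ∅
  | .app f _ _ C => insert (symMark f) (marksAboveHole C)

/-- One plus the supremum of the marks of the nodes of `C[l]` strictly above the occurrence of `x`
in `l` (the supremum of the empty set is `0`). -/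
noncomputable def newMark (C : Ctx (marked L)) (l : (marked L).Term ℕ) (x : ℕ) : ℕ :=
  sSup (marksAboveHole C ∪ {j | MarkAboveVar l x j}) + 1

/-- The marked rewriting step `C[l σ] ∘→ C[r σ']` that applies the rule `ρ` in the marked context
`C`: here `l` is a marked version of the left-hand side of `ρ`, the right-hand side `r` receives the
marks `0`, and in `σ'` the marks of `x σ` have been raised to at least `newMark C l x`. -/
def MarkedStepAt (ρ : Rule L) (C : Ctx (marked L)) (l : (marked L).Term ℕ)
    (σ : ℕ → (marked L).Term Empty) (s t : (marked L).Term Empty) : Prop :=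
  unmark l = ρ.lhs ∧
  s = C.plug (l.subst σ) ∧
  t = C.plug ((zeroMark ρ.rhs).subst fun x => raise (σ x) (newMark C l x))

/-- The condition on a step that makes a marked derivation weakly bottom-up: the root of the
left-hand side `l` has the mark `0`; if `l` is a variable, all nodes strictly above the place where
the rule is applied have the mark `0` instead. -/
def WeaklyBottomUpAt (C : Ctx (marked L)) : (marked L).Term ℕ → Prop
  | .var _ => ∀ j ∈ marksAboveHole C, j = 0
  | .func f ts => rootMark (.func f ts : (marked L).Term ℕ) = 0

/-- A weakly bottom-up marked step between two terms all of whose marks are at most `k`. -/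
def BUMarkedStep (R : Set (Rule L)) (k : ℕ) (s t : (marked L).Term Empty) : Prop :=
  maxMark s ≤ k ∧ maxMark t ≤ k ∧
  ∃ ρ ∈ R, ∃ (C : Ctx (marked L)) (l : (marked L).Term ℕ) (σ : ℕ → (marked L).Term Empty),
    MarkedStepAt ρ C l σ s t ∧ WeaklyBottomUpAt C l

/-- Bottom-up(`k`) rewriting on ground terms: there is a marked derivation that starts from `s` with
all marks `0`, ends in a marked version of `t`, is weakly bottom-up, and has no mark above `k`. -/
def BUDerives (R : Set (Rule L)) (k : ℕ) (s t : L.Term Empty) : Prop :=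
  ∃ t' : (marked L).Term Empty,
    Relation.ReflTransGen (BUMarkedStep R k) (zeroMark s) t' ∧ unmark t' = t

/-- The class BU(`k`): every derivation between ground terms can be replaced by a
bottom-up(`k`) derivation. -/
def IsBUk (R : Set (Rule L)) (k : ℕ) : Prop :=
  ∀ s t : L.Term Empty, Derives R s t → BUDerives R k s t

/-- The class BU, the union of the classes BU(`k`). -/
def IsBU (R : Set (Rule L)) : Prop := ∃ k, IsBUk R k

end Marking

section Automata

/-- A (nondeterministic, bottom-up) finite tree automaton with state set `Q`: `q ∈ trans f qs`
means that there is a transition `f(qs 0, …, qs (n-1)) → q`. -/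
structure TreeAutomaton (L : FirstOrder.Language.{u, v}) (Q : Type) where
  trans : ∀ {n : ℕ}, L.Functions n → (Fin n → Q) → Set Q
  final : Set Q

variable {L : FirstOrder.Language.{u, v}}

/-- `A.Reaches t q`: the automaton can reduce the ground term `t` to the state `q`. -/
inductive TreeAutomaton.Reaches {Q : Type} (A : TreeAutomaton L Q) : L.Term Empty → Q → Prop
  | node {n : ℕ} (f : L.Functions n) (ts : Fin n → L.Term Empty) (qs : Fin n → Q) (q : Q) :
      (∀ i, A.Reaches (ts i) (qs i)) → q ∈ A.trans f qs → A.Reaches (.func f ts) q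

/-- The tree language recognized by an automaton. -/
def TreeAutomaton.language {Q : Type} (A : TreeAutomaton L Q) : Set (L.Term Empty) :=
  {t | ∃ q ∈ A.final, A.Reaches t q}

/-- A set of ground terms is recognizable if some automaton with finitely many states
recognizes it. -/
def Recognizable (T : Set (L.Term Empty)) : Prop :=
  ∃ (Q : Type) (_ : Finite Q) (A : TreeAutomaton L Q), A.language = T

/-- `R` is inverse-recognizability preserving: the ancestors of a recognizable set form a
recognizable set. -/
def InverseRecognizabilityPreserving (R : Set (Rule L)) : Prop :=
  ∀ T : Set (L.Term Empty), Recognizable T → Recognizable (ancestors (Derives R) T)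

end Automata

end BottomUp

/-!
# Ancestors of recognizable sets under bounded bottom-up rewriting

Removing the marks turns a bottom-up derivation into a derivation, so for a system in `BU(k)` the
relations `Derives R` and `BUDerives R k` coincide, and everything rests on
`recognizable_ancestors_buDerives`: for a finite linear system the ancestors of a recognizable set
for bottom-up(`k`) derivations form a recognizable set.

Along a derivation that starts with all marks `0`, the marks never decrease from the root towards
the leaves. A weakly bottom-up step therefore takes place below nodes of mark `0` only, and what it
substitutes for a variable gets marks larger than all marks above that variable in the left-hand
side (`ZeroStep`, `buMarkedSteps_iff_zeroSteps`). If `d` bounds the depths of the left-hand sides, a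
single step inspects at most `d` levels below the topmost positive mark of a branch, and what it
leaves there has larger marks. As no mark exceeds `k`, of a region with marks at least `i > 0` only
about `(k - i + 1) * d` levels can ever be inspected. All that matters about a subterm below them is
its value in the finite algebra that recognizes the target set, here the powerset algebra of an
automaton.

The function `cut` replaces the subterms out of reach by their values. Two terms all of whose cuts
agree (`Similar`) can copy each other's steps (`Similar.exists_zeroStep`). A step at the root has a
stronger effect: agreement of the cuts to `(k + 1) * (d + 1)` levels before the step is enough for
similarity after it (`exists_zeroStep_of_cut_eq`), because everything that the step moves has become
positively marked. Linearity is used here, so that subterms can be exchanged independently of each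
other.

The `profile` of a ground term `s` is the set of the cuts, at that depth, of the terms derivable
from `s`. Up to its first step at the root, a derivation from `f(s₁, …, sₙ)` consists of derivations
from the `sᵢ`, and from there on it can be copied; so the profile of `f(s₁, …, sₙ)` is determined by
`f` and the profiles of the `sᵢ` (`profile_func_subset`). There are finitely many profiles, and each
decides whether the target set can be reached. The Myhill–Nerode criterion
`recognizable_of_finite_range` concludes.
-/

namespace BottomUp

open FirstOrder.Language

universe u v w

/-! ### Removal of marks, variables, depth, and maximal marks -/

section Basic

variable {L : FirstOrder.Language.{u, v}} {α β : Type*}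

theorem unmark_subst (t : (marked L).Term α) (σ : α → (marked L).Term β) :
    unmark (t.subst σ) = (unmark t).subst fun x => unmark (σ x) := by
  induction t with
  | var x => rfl
  | func f ts ih => simp only [Term.subst, unmark, ih]

@[simp] theorem unmark_zeroMark (t : L.Term α) : unmark (zeroMark t) = t := by
  induction t with
  | var x => rfl
  | func f ts ih => simp only [zeroMark, unmark, ih]; rfl

@[simp] theorem unmark_raise (t : (marked L).Term α) (j : ℕ) : unmark (raise t j) = unmark t := by
  induction t with
  | var x => rfl
  | func f ts ih => simp only [raise, unmark, ih]; rfl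

/-- Removal of all marks from a context. -/
def unmarkCtx : Ctx (marked L) → Ctx L
  | .hole => .hole
  | .app f ts i C => .app (symBase f) (fun j => unmark (ts j)) i (unmarkCtx C)

theorem unmark_plug (C : Ctx (marked L)) (t : (marked L).Term Empty) :
    unmark (C.plug t) = (unmarkCtx C).plug (unmark t) := by
  induction C with
  | hole => rfl
  | app f ts i C ih =>
    simp only [Ctx.plug, unmarkCtx, unmark, ← ih]
    congr 1
    funext j
    by_cases h : j = i
    · subst h; simp
    · simp [h]

theorem BUMarkedStep.step {R : Set (Rule L)} {k : ℕ} {s t : (marked L).Term Empty}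
    (h : BUMarkedStep R k s t) : Step R (unmark s) (unmark t) := by
  obtain ⟨-, -, ρ, hρ, C, l, σ, ⟨hl, rfl, rfl⟩, -⟩ := h
  refine ⟨ρ, hρ, unmarkCtx C, fun x => unmark (σ x), ?_, ?_⟩
  · rw [unmark_plug, unmark_subst, hl]
  · rw [unmark_plug, unmark_subst, unmark_zeroMark]; simp only [unmark_raise]

theorem BUDerives.derives {R : Set (Rule L)} {k : ℕ} {s t : L.Term Empty}
    (h : BUDerives R k s t) : Derives R s t := by
  obtain ⟨t', h, rfl⟩ := h
  have : Relation.ReflTransGen (Step R) _ _ :=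
    Relation.ReflTransGen.lift (p := Step R) unmark (fun _ _ => BUMarkedStep.step) _ _ h
  rwa [unmark_zeroMark] at this

theorem mem_varFinset_func {n : ℕ} (f : L.Functions n) (ts : Fin n → L.Term ℕ) (x : ℕ) :
    x ∈ (Term.func f ts).varFinset ↔ ∃ i, x ∈ (ts i).varFinset := by
  simp [Term.varFinset]

theorem varFinset_unmark (t : (marked L).Term ℕ) : (unmark t).varFinset = t.varFinset := by
  induction t with
  | var x => rfl
  | func f ts ih => simp only [unmark, Term.varFinset, ih]

theorem occ_unmark (x : ℕ) (t : (marked L).Term ℕ) : occ x (unmark t) = occ x t := by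
  induction t with
  | var y => rfl
  | func f ts ih => simp only [unmark, occ, ih]

theorem occ_pos_of_mem {x : ℕ} {t : L.Term ℕ} (h : x ∈ t.varFinset) : 0 < occ x t := by
  induction t with
  | var y => simp [Term.varFinset] at h; simp [occ, h]
  | func f ts ih =>
    obtain ⟨i, hi⟩ := (mem_varFinset_func f ts x).1 h
    exact (ih i hi).trans_le (Finset.single_le_sum (f := fun i => occ x (ts i))
      (fun _ _ => Nat.zero_le _) (Finset.mem_univ i))

theorem IsLinear.arg {n : ℕ} {f : L.Functions n} {ts : Fin n → L.Term ℕ}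
    (h : IsLinear (.func f ts)) (i : Fin n) : IsLinear (ts i) := fun x =>
  (Finset.single_le_sum (f := fun i => occ x (ts i))
      (fun _ _ => Nat.zero_le _) (Finset.mem_univ i)).trans (h x)

theorem IsLinear.arg_unique {n : ℕ} {f : L.Functions n} {ts : Fin n → L.Term ℕ}
    (h : IsLinear (.func f ts)) {i j : Fin n} {x : ℕ} (hi : x ∈ (ts i).varFinset)
    (hj : x ∈ (ts j).varFinset) : i = j := by
  by_contra hij
  have h1 : ∑ a ∈ {i, j}, occ x (ts a) ≤ ∑ a, occ x (ts a) :=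
    Finset.sum_le_sum_of_subset (Finset.subset_univ _)
  rw [Finset.sum_pair hij] at h1
  have h2 := h x
  have := occ_pos_of_mem hi
  have := occ_pos_of_mem hj
  simp only [occ] at h2
  omega

theorem subst_congr_of_mem {t : L.Term ℕ} {σ τ : ℕ → L.Term α}
    (h : ∀ x ∈ t.varFinset, σ x = τ x) : t.subst σ = t.subst τ := by
  induction t with
  | var x => exact h x (by simp [Term.varFinset])
  | func f ts ih =>
    simp only [Term.subst]
    congr 1
    funext i
    exact ih i fun x hx => h x ((mem_varFinset_func f ts x).2 ⟨i, hx⟩)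

/-- Depth of a term; variables have depth `0` and constants have depth `1`. -/
def depth : L.Term α → ℕ
  | .var _ => 0
  | .func _ ts => (Finset.univ.sup fun i => depth (ts i)) + 1

theorem depth_arg_lt {n : ℕ} (f : L.Functions n) (ts : Fin n → L.Term α) (i : Fin n) :
    depth (ts i) < depth (.func f ts) :=
  Nat.lt_succ_of_le (Finset.le_sup (f := fun i => depth (ts i)) (Finset.mem_univ i))

theorem depth_unmark (t : (marked L).Term α) : depth (unmark t) = depth t := by
  induction t with
  | var y => rfl
  | func f ts ih => simp only [unmark, depth, ih]

theorem maxMark_func_le {n k : ℕ} {f : (marked L).Functions n} {ts : Fin n → (marked L).Term α} :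
    maxMark (.func f ts) ≤ k ↔ symMark f ≤ k ∧ ∀ i, maxMark (ts i) ≤ k := by
  simp [maxMark]

theorem maxMark_zeroMark (t : L.Term α) : maxMark (zeroMark t) ≤ 0 := by
  induction t with
  | var x => exact le_rfl
  | func f ts ih => exact maxMark_func_le.2 ⟨le_rfl, ih⟩

theorem maxMark_raise_le {t : (marked L).Term α} {j k : ℕ} (ht : maxMark t ≤ k) (hj : j ≤ k) :
    maxMark (raise t j) ≤ k := by
  induction t with
  | var x => exact Nat.zero_le _
  | func f ts ih =>
    rw [maxMark_func_le] at ht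
    exact maxMark_func_le.2 ⟨max_le ht.1 hj, fun i => ih i (ht.2 i)⟩

theorem le_maxMark_raise (t : (marked L).Term Empty) (j : ℕ) : j ≤ maxMark (raise t j) := by
  cases t with
  | var x => exact x.elim
  | func f ts => exact (le_max_right (symMark f) j).trans (le_max_left _ _)

theorem maxMark_subst_le {t : (marked L).Term ℕ} {σ : ℕ → (marked L).Term α} {k : ℕ} :
    maxMark (t.subst σ) ≤ k ↔ maxMark t ≤ k ∧ ∀ x ∈ t.varFinset, maxMark (σ x) ≤ k := by
  induction t with
  | var x => simp [Term.subst, Term.varFinset, maxMark]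
  | func f ts ih =>
    simp only [Term.subst, maxMark_func_le, ih, mem_varFinset_func]
    grind

theorem maxMark_plug_le {C : Ctx (marked L)} {t : (marked L).Term Empty} {k : ℕ}
    (h : maxMark (C.plug t) ≤ k) : maxMark t ≤ k := by
  induction C with
  | hole => exact h
  | app f ts i C ih =>
    have := (maxMark_func_le.1 h).2 i
    rw [Function.update_self] at this
    exact ih this

theorem varFinset_zeroMark (t : L.Term ℕ) : (zeroMark t).varFinset = t.varFinset := by
  rw [← varFinset_unmark, unmark_zeroMark]

end Basic

/-! ### Marks that do not decrease downwards -/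

section Monotone

variable {L : FirstOrder.Language.{u, v}}

/-- All marks of the ground term are at least `j`. -/
def MarksGE (j : ℕ) : (marked L).Term Empty → Prop
  | .var _ => True
  | .func f ts => j ≤ symMark f ∧ ∀ i, MarksGE j (ts i)

/-- The marks do not decrease on the way from the root to the leaves. -/
def MonoMarks : (marked L).Term Empty → Prop
  | .var _ => True
  | .func f ts => ∀ i, MarksGE (symMark f) (ts i) ∧ MonoMarks (ts i)

theorem marksGE_zero (t : (marked L).Term Empty) : MarksGE 0 t := by
  induction t with
  | var x => trivial
  | func f ts ih => exact ⟨Nat.zero_le _, ih⟩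

theorem MarksGE.raise {t : (marked L).Term Empty} {i : ℕ} (h : MarksGE i t) (j : ℕ) :
    MarksGE (max i j) (raise t j) := by
  induction t with
  | var x => trivial
  | func f ts ih => exact ⟨max_le_max_right j h.1, fun a => ih a (h.2 a)⟩

theorem MonoMarks.raise {t : (marked L).Term Empty} (h : MonoMarks t) (j : ℕ) :
    MonoMarks (raise t j) := by
  induction t with
  | var x => trivial
  | func f ts ih => exact fun a => ⟨(h a).1.raise j, ih a (h a).2⟩

theorem MonoMarks.subst_zeroMark {t : L.Term ℕ} {σ : ℕ → (marked L).Term Empty}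
    (h : ∀ x ∈ t.varFinset, MonoMarks (σ x)) : MonoMarks ((zeroMark t).subst σ) := by
  induction t with
  | var x => exact h x (by simp [Term.varFinset])
  | func f ts ih =>
    exact fun i => ⟨marksGE_zero _, ih i fun x hx => h x ((mem_varFinset_func f ts x).2 ⟨i, hx⟩)⟩

theorem MonoMarks.of_subst {t : (marked L).Term ℕ} {σ : ℕ → (marked L).Term Empty}
    (h : MonoMarks (t.subst σ)) {x : ℕ} (hx : x ∈ t.varFinset) : MonoMarks (σ x) := by
  induction t with
  | var y => simp [Term.varFinset] at hx; subst hx; exact h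
  | func f ts ih =>
    obtain ⟨i, hi⟩ := (mem_varFinset_func f ts x).1 hx
    exact ih i (h i).2 hi

theorem monoMarks_zeroMark (t : L.Term Empty) : MonoMarks (zeroMark t) := by
  induction t with
  | var x => trivial
  | func f ts ih => exact fun i => ⟨marksGE_zero _, ih i⟩

/-- In a term with monotone marks, all nodes above a subterm with a mark `0` have the mark `0`; that
the mark occurs is expressed by saying that `0` is the only lower bound of the marks. The second
conjunct carries the induction on the context. -/
theorem marksAboveHole_eq_zero {C : Ctx (marked L)} {t : (marked L).Term Empty}
    (h : MonoMarks (C.plug t)) (ht : ∀ j, MarksGE j t → j = 0) :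
    (∀ j ∈ marksAboveHole C, j = 0) ∧ ∀ j, MarksGE j (C.plug t) → j = 0 := by
  induction C with
  | hole => exact ⟨fun _ h => h.elim, ht⟩
  | app f ts i C ih =>
    have hi := h i
    simp only [Function.update_self] at hi
    obtain ⟨h1, h2⟩ := ih hi.2
    refine ⟨?_, fun j hj => h2 j ?_⟩
    · rintro j (rfl | hj)
      · exact h2 _ hi.1
      · exact h1 j hj
    · have := hj.2 i
      rwa [Function.update_self] at this

end Monotone

/-! ### Steps below nodes of mark zero -/

section LocalSteps

variable {L : FirstOrder.Language.{u, v}}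

/-- A weakly bottom-up step below nodes of mark `0` only. No mark of the context contributes to the
marks created by the step, and the bound `k` is imposed on these new marks alone. -/
inductive ZeroStep (R : Set (Rule L)) (k : ℕ) :
    (marked L).Term Empty → (marked L).Term Empty → Prop
  | root (ρ : Rule L) (l : (marked L).Term ℕ) (σ : ℕ → (marked L).Term Empty) :
      ρ ∈ R → unmark l = ρ.lhs → rootMark l = 0 →
      (∀ x ∈ ρ.rhs.varFinset, newMark .hole l x ≤ k) →
      ZeroStep R k (l.subst σ) ((zeroMark ρ.rhs).subst fun x => raise (σ x) (newMark .hole l x))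
  | arg {n : ℕ} (f : (marked L).Functions n) (ts : Fin n → (marked L).Term Empty) (i : Fin n)
      (t : (marked L).Term Empty) : symMark f = 0 → ZeroStep R k (ts i) t →
      ZeroStep R k (.func f ts) (.func f (Function.update ts i t))

theorem MarkAboveVar.le_maxMark {l : (marked L).Term ℕ} {x j : ℕ} (h : MarkAboveVar l x j) :
    j ≤ maxMark l := by
  induction h with
  | root f ts i x hx => exact le_max_left _ _
  | arg f ts i x j h ih => exact ih.trans ((maxMark_func_le.1 le_rfl).2 i)

theorem bddAbove_markAboveVar (l : (marked L).Term ℕ) (x : ℕ) :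
    BddAbove {j | MarkAboveVar l x j} := ⟨maxMark l, fun _ h => h.le_maxMark⟩

theorem newMark_hole (l : (marked L).Term ℕ) (x : ℕ) :
    newMark .hole l x = sSup {j | MarkAboveVar l x j} + 1 := by
  simp [newMark, marksAboveHole]

/-- A context with the marks `0` above its hole does not contribute to the new marks, even where no
mark lies above the variable in `l`, since the supremum of the empty set is `0` as well. -/
theorem newMark_eq_hole {C : Ctx (marked L)} (h : ∀ j ∈ marksAboveHole C, j = 0)
    (l : (marked L).Term ℕ) (x : ℕ) : newMark C l x = newMark .hole l x := by
  rw [newMark_hole, newMark]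
  congr 1
  have hC : BddAbove (marksAboveHole C) := ⟨0, fun j hj => (h j hj).le⟩
  apply le_antisymm
  · by_cases hne : (marksAboveHole C ∪ {j | MarkAboveVar l x j}).Nonempty
    · refine csSup_le hne ?_
      rintro j (hj | hj)
      · simp [h j hj]
      · exact le_csSup (bddAbove_markAboveVar l x) hj
    · rw [Set.not_nonempty_iff_eq_empty.1 hne]; simp
  · by_cases hne : {j | MarkAboveVar l x j}.Nonempty
    · exact csSup_le_csSup (hC.union (bddAbove_markAboveVar l x)) hne Set.subset_union_right
    · rw [Set.not_nonempty_iff_eq_empty.1 hne]; simp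

theorem ZeroStep.plug {R : Set (Rule L)} {k : ℕ} {s t : (marked L).Term Empty}
    (h : ZeroStep R k s t) {C : Ctx (marked L)} (hC : ∀ j ∈ marksAboveHole C, j = 0) :
    ZeroStep R k (C.plug s) (C.plug t) := by
  induction C with
  | hole => exact h
  | app f ts i C ih =>
    have := ZeroStep.arg (R := R) (k := k) f (Function.update ts i (C.plug s)) i (C.plug t)
      (hC _ (Set.mem_insert _ _)) (by
        rw [Function.update_self]; exact ih fun j hj => hC j (Set.mem_insert_of_mem _ hj))
    rwa [Function.update_idem] at this

theorem BUMarkedStep.zeroStep {R : Set (Rule L)} {k : ℕ} {s t : (marked L).Term Empty}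
    (h : BUMarkedStep R k s t) (hs : MonoMarks s) : ZeroStep R k s t := by
  obtain ⟨-, htk, ρ, hρ, C, l, σ, ⟨hl, rfl, rfl⟩, hw⟩ := h
  have hC : ∀ j ∈ marksAboveHole C, j = 0 := by
    cases l with
    | var x => exact hw
    | func f ts =>
      exact (marksAboveHole_eq_zero hs fun j hj => Nat.le_zero.1 (hj.1.trans_eq hw)).1
  have hroot : rootMark l = 0 := by
    cases l with
    | var x => rfl
    | func f ts => exact hw
  simp only [newMark_eq_hole hC] at htk ⊢
  refine ZeroStep.plug (.root ρ l σ hρ hl hroot fun x hx => ?_) hC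
  exact (le_maxMark_raise _ _).trans
    ((maxMark_subst_le.1 (maxMark_plug_le htk)).2 x (by rwa [varFinset_zeroMark]))

theorem ZeroStep.monoMarks {R : Set (Rule L)} {k : ℕ} {s t : (marked L).Term Empty}
    (h : ZeroStep R k s t) (hs : MonoMarks s) : MonoMarks t := by
  induction h with
  | root ρ l σ hρ hl hr hk =>
    refine MonoMarks.subst_zeroMark fun x hx => (hs.of_subst ?_).raise _
    rw [← varFinset_unmark, hl]
    exact ρ.vars_subset hx
  | arg f ts i t hf h ih =>
    intro j
    rw [hf]
    refine ⟨marksGE_zero _, ?_⟩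
    by_cases hj : j = i
    · subst hj; rw [Function.update_self]; exact ih (hs j).2
    · rw [Function.update_of_ne hj]; exact (hs j).2

theorem ZeroStep.maxMark_le {R : Set (Rule L)} {k : ℕ} {s t : (marked L).Term Empty}
    (h : ZeroStep R k s t) (hs : maxMark s ≤ k) : maxMark t ≤ k := by
  induction h with
  | root ρ l σ hρ hl hr hk =>
    refine maxMark_subst_le.2 ⟨(maxMark_zeroMark _).trans (Nat.zero_le _), fun x hx => ?_⟩
    rw [varFinset_zeroMark] at hx
    refine maxMark_raise_le ((maxMark_subst_le.1 hs).2 x ?_) (hk x hx)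
    rw [← varFinset_unmark, hl]
    exact ρ.vars_subset hx
  | arg f ts i t hf h ih =>
    rw [maxMark_func_le] at hs ⊢
    refine ⟨hs.1, fun j => ?_⟩
    by_cases hj : j = i
    · subst hj; rw [Function.update_self]; exact ih (hs.2 j)
    · rw [Function.update_of_ne hj]; exact hs.2 j

theorem ZeroStep.exists_context {R : Set (Rule L)} {k : ℕ} {s t : (marked L).Term Empty}
    (h : ZeroStep R k s t) :
    ∃ C : Ctx (marked L), (∀ j ∈ marksAboveHole C, j = 0) ∧
      ∃ ρ ∈ R, ∃ l σ, rootMark l = 0 ∧ MarkedStepAt ρ C l σ s t := by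
  induction h with
  | root ρ l σ hρ hl hr hk => exact ⟨.hole, fun _ h => h.elim, ρ, hρ, l, σ, hr, hl, rfl, rfl⟩
  | arg f ts i t hf h ih =>
    obtain ⟨C, hC, ρ, hρ, l, σ, hr, hl, hs, ht⟩ := ih
    have hC' : ∀ j ∈ marksAboveHole (.app f ts i C), j = 0 := by
      rintro j (rfl | hj)
      exacts [hf, hC j hj]
    refine ⟨.app f ts i C, hC', ρ, hρ, l, σ, hr, hl, ?_, ?_⟩
    · rw [Ctx.plug, ← hs, Function.update_eq_self]
    · simp only [Ctx.plug, newMark_eq_hole hC']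
      simp only [newMark_eq_hole hC] at ht
      rw [← ht]

theorem ZeroStep.buMarkedStep {R : Set (Rule L)} {k : ℕ} {s t : (marked L).Term Empty}
    (h : ZeroStep R k s t) (hs : maxMark s ≤ k) : BUMarkedStep R k s t := by
  obtain ⟨C, hC, ρ, hρ, l, σ, hr, hst⟩ := h.exists_context
  refine ⟨hs, h.maxMark_le hs, ρ, hρ, C, l, σ, hst, ?_⟩
  cases l with
  | var x => exact hC
  | func f ts => exact hr

theorem maxMark_le_of_zeroSteps {R : Set (Rule L)} {k : ℕ} {s : L.Term Empty}
    {t : (marked L).Term Empty} (h : Relation.ReflTransGen (ZeroStep R k) (zeroMark s) t) :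
    maxMark t ≤ k := by
  induction h with
  | refl => exact (maxMark_zeroMark s).trans (Nat.zero_le _)
  | tail _ h ih => exact h.maxMark_le ih

theorem buMarkedSteps_iff_zeroSteps {R : Set (Rule L)} {k : ℕ} {s : L.Term Empty}
    {t : (marked L).Term Empty} :
    Relation.ReflTransGen (BUMarkedStep R k) (zeroMark s) t ↔
      Relation.ReflTransGen (ZeroStep R k) (zeroMark s) t := by
  constructor
  · intro h
    have : Relation.ReflTransGen (ZeroStep R k) (zeroMark s) t ∧ MonoMarks t := by
      induction h with
      | refl => exact ⟨.refl, monoMarks_zeroMark s⟩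
      | tail _ h ih => exact ⟨ih.1.tail (h.zeroStep ih.2), (h.zeroStep ih.2).monoMarks ih.2⟩
    exact this.1
  · intro h
    induction h with
    | refl => exact .refl
    | tail h' h ih => exact ih.tail (h.buMarkedStep (maxMark_le_of_zeroSteps h'))

end LocalSteps

/-! ### Truncation, and the copying of steps -/

section Truncation

variable {L : FirstOrder.Language.{u, v}} {D : Type w} [L.Structure D]

/-- The value of a ground marked term in an algebra; marks are ignored. -/
def val (D : Type w) [L.Structure D] (t : (marked L).Term Empty) : D :=
  (unmark t).realize Empty.elim

/-- The number of levels of the arguments of a node of mark `i` that remain visible when `b` of them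
are visible by the position of the node. Marks `i > 0` impose the bound `(k - i) * (d + 1) + d`. -/
def visible (d k i b : ℕ) : ℕ := if i = 0 then b else min b ((k - i) * (d + 1) + d)

variable (D) in
/-- Truncation of a marked ground term: the top `b` levels are kept, fewer below positive marks, and
each subterm beneath is replaced by its value in the algebra `D`, used as a variable. -/
def cut (d k : ℕ) : ℕ → (marked L).Term Empty → (marked L).Term D
  | _, .var x => x.elim
  | 0, .func f ts => .var (val D (.func f ts))
  | b + 1, .func f ts => .func f fun i => cut d k (visible d k (symMark f) b) (ts i)

theorem val_func {n : ℕ} (f : (marked L).Functions n) (ts : Fin n → (marked L).Term Empty) :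
    val D (.func f ts) = Structure.funMap (symBase f) fun i => val D (ts i) := rfl

theorem val_raise (t : (marked L).Term Empty) (j : ℕ) : val D (raise t j) = val D t := by
  rw [val, unmark_raise, val]

theorem cut_zero (d k : ℕ) (t : (marked L).Term Empty) : cut D d k 0 t = .var (val D t) := by
  cases t with
  | var x => exact x.elim
  | func f ts => rfl

theorem realize_unmark_cut (d k b : ℕ) (t : (marked L).Term Empty) :
    (unmark (cut D d k b t)).realize id = val D t := by
  induction t generalizing b with
  | var x => exact x.elim
  | func f ts ih =>
    cases b with
    | zero => rfl
    | succ b => simp only [cut, unmark, Term.realize, ih, val_func]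

theorem val_eq_of_cut_eq {d k b : ℕ} {s t : (marked L).Term Empty}
    (h : cut D d k b s = cut D d k b t) : val D s = val D t := by
  rw [← realize_unmark_cut d k b s, h, realize_unmark_cut]

theorem cut_zero_eq_iff {d k : ℕ} {s t : (marked L).Term Empty} :
    cut D d k 0 s = cut D d k 0 t ↔ val D s = val D t := by
  rw [cut_zero, cut_zero]
  exact ⟨fun h => Term.var.inj h, fun h => congrArg _ h⟩

theorem exists_eq_func_of_cut_eq {d k b n : ℕ} {f : (marked L).Functions n}
    {ts : Fin n → (marked L).Term Empty} {t : (marked L).Term Empty}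
    (h : cut D d k (b + 1) (.func f ts) = cut D d k (b + 1) t) :
    ∃ ts', t = .func f ts' ∧ ∀ i, cut D d k (visible d k (symMark f) b) (ts i) =
      cut D d k (visible d k (symMark f) b) (ts' i) := by
  cases t with
  | var x => exact x.elim
  | func g us =>
    simp only [cut, Term.func.injEq] at h
    obtain ⟨rfl, h⟩ := h
    obtain ⟨rfl, h⟩ := (by simpa using h)
    exact ⟨us, rfl, fun i => congrFun h i⟩

theorem cut_succ_func_eq {d k b n : ℕ} {f : (marked L).Functions n}
    {ts us : Fin n → (marked L).Term Empty}
    (h : ∀ i, cut D d k (visible d k (symMark f) b) (ts i) =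
      cut D d k (visible d k (symMark f) b) (us i)) :
    cut D d k (b + 1) (.func f ts) = cut D d k (b + 1) (.func f us) := by
  simp only [cut, h]

theorem visible_mono {d k i j a b : ℕ} (hij : i ≤ j) (hab : a ≤ b) :
    visible d k j a ≤ visible d k i b := by
  have := Nat.mul_le_mul_right (d + 1) (Nat.sub_le_sub_left hij k)
  unfold visible
  split_ifs <;> omega

/-- Truncations that agree still agree after the marks have been raised, because higher marks make
less of a term visible. -/
theorem cut_raise_eq {d k a b j : ℕ} (hab : a ≤ b) {s t : (marked L).Term Empty}
    (h : cut D d k b s = cut D d k b t) :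
    cut D d k a (raise s j) = cut D d k a (raise t j) := by
  induction s generalizing a b t with
  | var x => exact x.elim
  | func f ts ih =>
    cases a with
    | zero => rw [cut_zero_eq_iff, val_raise, val_raise]; exact val_eq_of_cut_eq h
    | succ a =>
      obtain ⟨b, rfl⟩ : ∃ c, b = c + 1 := ⟨b - 1, by omega⟩
      obtain ⟨us, rfl, hus⟩ := exists_eq_func_of_cut_eq h
      refine cut_succ_func_eq fun i => ih i ?_ (hus i)
      exact visible_mono (le_max_left _ _) (by omega)

theorem raise_zero (t : (marked L).Term Empty) : raise t 0 = t := by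
  induction t with
  | var x => rfl
  | func f ts ih =>
    simp only [raise, ih, Nat.max_zero]
    rfl

theorem cut_eq_of_le {d k a b : ℕ} (hab : a ≤ b) {s t : (marked L).Term Empty}
    (h : cut D d k b s = cut D d k b t) : cut D d k a s = cut D d k a t := by
  simpa only [raise_zero] using cut_raise_eq (j := 0) hab h

variable (D) in
/-- Two ground marked terms are similar if all their truncations agree: they differ only in subterms
that lie too deep below positive marks to be reached by a derivation with marks at most `k`, and
these have the same values. -/
def Similar (d k : ℕ) (s t : (marked L).Term Empty) : Prop :=
  ∀ b, cut D d k b s = cut D d k b t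

/-- Raising the marks to `j ≥ 1` makes two terms similar as soon as they agree to the depth that is
visible from a node of mark `j`. -/
theorem similar_raise {d k j : ℕ} (hj : 1 ≤ j) {s t : (marked L).Term Empty}
    (h : cut D d k ((k - j) * (d + 1) + d + 1) s = cut D d k ((k - j) * (d + 1) + d + 1) t) :
    Similar D d k (raise s j) (raise t j) := by
  intro a
  cases a with
  | zero => rw [cut_zero_eq_iff, val_raise, val_raise]; exact val_eq_of_cut_eq h
  | succ a =>
    cases s with
    | var x => exact x.elim
    | func f ts =>
      obtain ⟨us, rfl, hus⟩ := exists_eq_func_of_cut_eq h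
      refine cut_succ_func_eq fun i => cut_raise_eq ?_ (hus i)
      -- The raised root has a mark `m ≥ j`, which caps the visible depth, whatever `a` is.
      have h1 : symMark (withMark (symBase f) (max (symMark f) j)) = max (symMark f) j := rfl
      have h2 := Nat.mul_le_mul_right (d + 1)
        (Nat.sub_le_sub_left (le_max_left (symMark f) j) k)
      have h3 := Nat.mul_le_mul_right (d + 1)
        (Nat.sub_le_sub_left (le_max_right (symMark f) j) k)
      have h4 : max (symMark f) j ≠ 0 := by omega
      rw [h1]
      simp only [visible, h4, if_false]
      split_ifs <;> omega

theorem Similar.func {d k n : ℕ} {f : (marked L).Functions n}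
    {ts us : Fin n → (marked L).Term Empty} (h : ∀ i, Similar D d k (ts i) (us i)) :
    Similar D d k (.func f ts) (.func f us) := by
  intro b
  cases b with
  | zero =>
    rw [cut_zero_eq_iff, val_func, val_func]
    congr 1
    funext i
    exact val_eq_of_cut_eq (h i 0)
  | succ b => exact cut_succ_func_eq fun i => h i _

theorem Similar.subst {d k : ℕ} {r : (marked L).Term ℕ} {σ τ : ℕ → (marked L).Term Empty}
    (h : ∀ x ∈ r.varFinset, Similar D d k (σ x) (τ x)) :
    Similar D d k (r.subst σ) (r.subst τ) := by
  induction r with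
  | var x => exact h x (by simp [Term.varFinset])
  | func f ts ih =>
    exact Similar.func fun i => ih i fun x hx => h x ((mem_varFinset_func f ts x).2 ⟨i, hx⟩)

/-- A linear pattern `l` of depth at most `d + 1` that matches a term also matches each term with
the same truncation; the terms substituted for a variable `x` have a common truncation
whose depth depends on a bound `m` on the marks above `x`. -/
theorem exists_subst_of_cut_eq {d k b : ℕ} {l : (marked L).Term ℕ} (hlin : IsLinear l)
    (hd : depth l ≤ d + 1) (hb : depth l ≤ b) {σ : ℕ → (marked L).Term Empty}
    {t : (marked L).Term Empty} (h : cut D d k b (l.subst σ) = cut D d k b t) :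
    ∃ τ, t = l.subst τ ∧ ∀ x ∈ l.varFinset, ∀ m, (∀ j, MarkAboveVar l x j → j ≤ m) →
      depth l + (k - m) * (d + 1) ≤ b →
      cut D d k ((k - m) * (d + 1)) (σ x) = cut D d k ((k - m) * (d + 1)) (τ x) := by
  classical
  induction l generalizing b t with
  | var y =>
    refine ⟨fun _ => t, rfl, fun x hx m _ hm => ?_⟩
    simp [Term.varFinset] at hx
    subst hx
    exact cut_eq_of_le (by simpa [depth] using hm) h
  | func f ts ih =>
    obtain ⟨b, rfl⟩ : ∃ c, b = c + 1 := ⟨b - 1, by simp only [depth] at hb; omega⟩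
    obtain ⟨us, rfl, hus⟩ := exists_eq_func_of_cut_eq h
    have hdepth := fun i => depth_arg_lt f ts i
    have key : ∀ i, ∃ τ, us i = (ts i).subst τ ∧ ∀ x ∈ (ts i).varFinset, ∀ m,
        (∀ j, MarkAboveVar (ts i) x j → j ≤ m) →
        depth (ts i) + (k - m) * (d + 1) ≤ visible d k (symMark f) b →
        cut D d k ((k - m) * (d + 1)) (σ x) = cut D d k ((k - m) * (d + 1)) (τ x) := by
      intro i
      have := hdepth i
      refine ih i (hlin.arg i) (by omega) ?_ (hus i)
      unfold visible
      split_ifs <;> omega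
    choose τs h1 h2 using key
    -- By linearity, `x` occurs in at most one argument, so the substitutions found there combine.
    refine ⟨fun x => if hx : ∃ i, x ∈ (ts i).varFinset then τs hx.choose x else σ x, ?_, ?_⟩
    · simp only [Term.subst]
      congr 1
      funext i
      rw [h1 i]
      refine subst_congr_of_mem fun x hx => ?_
      have hex : ∃ i, x ∈ (ts i).varFinset := ⟨i, hx⟩
      rw [dif_pos hex, hlin.arg_unique hex.choose_spec hx]
    · intro x hx m hm hbm
      have hex := (mem_varFinset_func f ts x).1 hx
      simp only [dif_pos hex]
      refine h2 _ x hex.choose_spec m (fun j hj => hm j (.arg f ts _ x j hj)) ?_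
      have h3 := hm _ (.root f ts _ x hex.choose_spec)
      have h4 := Nat.mul_le_mul_right (d + 1) (Nat.sub_le_sub_left h3 k)
      have := hdepth hex.choose
      unfold visible
      split_ifs <;> omega

/-- A step at the root can be copied in each term whose truncation to `(k + 1) * (d + 1)` levels is
the same. The results are even similar: the new nodes have mark `0`, and the terms substituted
below them have received positive marks. -/
theorem exists_zeroStep_of_cut_eq {R : Set (Rule L)} (hlin : LinearSystem R) {d k b : ℕ}
    (hd : ∀ ρ ∈ R, depth ρ.lhs ≤ d) (hb : (k + 1) * (d + 1) ≤ b) {ρ : Rule L} (hρ : ρ ∈ R)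
    {l : (marked L).Term ℕ} (hl : unmark l = ρ.lhs) (hroot : rootMark l = 0)
    (hk : ∀ x ∈ ρ.rhs.varFinset, newMark .hole l x ≤ k) {σ : ℕ → (marked L).Term Empty}
    {t : (marked L).Term Empty} (h : cut D d k b (l.subst σ) = cut D d k b t) :
    ∃ t', ZeroStep R k t t' ∧
      Similar D d k ((zeroMark ρ.rhs).subst fun x => raise (σ x) (newMark .hole l x)) t' := by
  have hdl : depth l ≤ d := by rw [← depth_unmark, hl]; exact hd ρ hρ
  have hll : IsLinear l := fun x => by rw [← occ_unmark, hl]; exact (hlin ρ hρ).1 x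
  have hkd : (k + 1) * (d + 1) = k * (d + 1) + d + 1 := by ring
  obtain ⟨τ, rfl, hτ⟩ := exists_subst_of_cut_eq hll (by omega) (by omega) h
  refine ⟨_, .root ρ l τ hρ hl hroot hk, Similar.subst fun x hx => ?_⟩
  rw [varFinset_zeroMark] at hx
  have hkx := hk x hx
  rw [newMark_hole] at hkx ⊢
  set m := sSup {j | MarkAboveVar l x j}
  refine similar_raise (Nat.le_add_left 1 m) ?_
  have e : (k - (m + 1)) * (d + 1) + d + 1 = (k - m) * (d + 1) := by
    obtain ⟨c, rfl⟩ := Nat.exists_eq_add_of_le hkx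
    rw [show m + 1 + c - (m + 1) = c by omega, show m + 1 + c - m = c + 1 by omega]
    ring
  rw [e]
  refine hτ x ?_ m (fun j hj => le_csSup (bddAbove_markAboveVar l x) hj) ?_
  · rw [← varFinset_unmark, hl]; exact ρ.vars_subset hx
  · have := Nat.mul_le_mul_right (d + 1) (Nat.sub_le k m)
    omega

/-- Similarity is a simulation: as all nodes above the redex have the mark `0`, the terms at the redex
are similar again. -/
theorem Similar.exists_zeroStep {R : Set (Rule L)} (hlin : LinearSystem R) {d k : ℕ}
    (hd : ∀ ρ ∈ R, depth ρ.lhs ≤ d) {s s' t : (marked L).Term Empty} (hst : Similar D d k s t)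
    (h : ZeroStep R k s s') : ∃ t', ZeroStep R k t t' ∧ Similar D d k s' t' := by
  induction h generalizing t with
  | root ρ l σ hρ hl hr hk => exact exists_zeroStep_of_cut_eq hlin hd le_rfl hρ hl hr hk (hst _)
  | arg f ts i u hf h ih =>
    obtain ⟨us, rfl, -⟩ := exists_eq_func_of_cut_eq (hst 1)
    have hus : ∀ j, Similar D d k (ts j) (us j) := by
      intro j b
      obtain ⟨us', he, hus'⟩ := exists_eq_func_of_cut_eq (hst (b + 1))
      obtain rfl : us = us' := by simpa using he
      simpa [visible, hf] using hus' j
    obtain ⟨u', hu', hs⟩ := ih (hus i)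
    refine ⟨_, .arg f us i u' hf hu', Similar.func fun j => ?_⟩
    by_cases hj : j = i
    · subst hj; simpa using hs
    · simpa [hj] using hus j

end Truncation

/-! ### Profiles of ground terms -/

section Profiles

variable {L : FirstOrder.Language.{u, v}} {D : Type w} [L.Structure D]

variable (D) in
/-- The truncations, to the depth that a step can inspect, of the terms derivable from `s`. -/
def profile (R : Set (Rule L)) (d k : ℕ) (s : L.Term Empty) : Set ((marked L).Term D) :=
  cut D d k ((k + 1) * (d + 1)) '' {t | Relation.ReflTransGen (ZeroStep R k) (zeroMark s) t}

/-- Derivations from the arguments of a node of mark `0` combine to a derivation from the node. -/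
theorem zeroSteps_func {R : Set (Rule L)} {k n : ℕ} {f : (marked L).Functions n}
    (hf : symMark f = 0) {ss ts : Fin n → (marked L).Term Empty}
    (h : ∀ i, Relation.ReflTransGen (ZeroStep R k) (ss i) (ts i)) :
    Relation.ReflTransGen (ZeroStep R k) (.func f ss) (.func f ts) := by
  classical
  -- The arguments are rewritten one after the other.
  have key : ∀ S : Finset (Fin n), Relation.ReflTransGen (ZeroStep R k) (.func f ss)
      (.func f fun i => if i ∈ S then ts i else ss i) := by
    intro S
    induction S using Finset.induction_on with
    | empty => simpa using Relation.ReflTransGen.refl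
    | insert i S hi ih =>
      refine ih.trans ?_
      have := Relation.ReflTransGen.lift (p := ZeroStep R k)
        (fun u => .func f (Function.update (fun j => if j ∈ S then ts j else ss j) i u))
        (fun a b hab => by
          have := ZeroStep.arg (R := R) (k := k) f
            (Function.update (fun j => if j ∈ S then ts j else ss j) i a) i b hf (by simpa using hab)
          simpa using this) _ _ (h i)
      have e1 : Function.update (fun j => if j ∈ S then ts j else ss j) i (ss i) =
          fun j => if j ∈ S then ts j else ss j := by
        rw [Function.update_eq_self_iff]; simp [hi]
      have e2 : Function.update (fun j => if j ∈ S then ts j else ss j) i (ts i) =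
          fun j => if j ∈ insert i S then ts j else ss j := by
        funext j
        by_cases hj : j = i
        · subst hj; simp
        · simp [hj]
      rwa [Function.onFun, e1, e2] at this
  simpa using key Finset.univ

/-- The profile of `f(s₁, …, sₙ)` is determined by `f` and the profiles of the arguments. -/
theorem profile_func_subset {R : Set (Rule L)} (hlin : LinearSystem R) {d k : ℕ}
    (hd : ∀ ρ ∈ R, depth ρ.lhs ≤ d) {n : ℕ} (f : L.Functions n) {ss us : Fin n → L.Term Empty}
    (h : ∀ i, profile D R d k (ss i) ⊆ profile D R d k (us i)) :
    profile D R d k (.func f ss) ⊆ profile D R d k (.func f us) := by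
  have lift : ∀ ts : Fin n → (marked L).Term Empty,
      (∀ i, Relation.ReflTransGen (ZeroStep R k) (zeroMark (ss i)) (ts i)) →
      ∃ ts', Relation.ReflTransGen (ZeroStep R k) (zeroMark (.func f us))
        (.func (withMark f 0) ts') ∧ cut D d k ((k + 1) * (d + 1) + 1) (.func (withMark f 0) ts) =
          cut D d k ((k + 1) * (d + 1) + 1) (.func (withMark f 0) ts') := by
    intro ts hts
    choose ts' h1 h2 using fun i => h i ⟨ts i, hts i, rfl⟩
    exact ⟨ts', zeroSteps_func rfl h1, cut_succ_func_eq fun i => (h2 i).symm⟩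
  rintro _ ⟨t, ht, rfl⟩
  -- Either no step has been made at the root so far, or the derivation has been copied.
  have key : (∃ ts, t = .func (withMark f 0) ts ∧
      ∀ i, Relation.ReflTransGen (ZeroStep R k) (zeroMark (ss i)) (ts i)) ∨
      ∃ t', Relation.ReflTransGen (ZeroStep R k) (zeroMark (.func f us)) t' ∧
        Similar D d k t t' := by
    induction ht with
    | refl => exact .inl ⟨_, rfl, fun _ => .refl⟩
    | @tail t t₁ _ hstep ih =>
      obtain ⟨ts, rfl, hts⟩ | ⟨t', ht', hsim⟩ := ih
      · generalize hs : (Term.func (withMark f 0) ts : (marked L).Term Empty) = s at hstep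
        cases hstep with
        | root ρ l σ hρ hl hr hk =>
          obtain ⟨ts', h1, h2⟩ := lift ts hts
          rw [hs] at h2
          obtain ⟨t', h3, h4⟩ :=
            exists_zeroStep_of_cut_eq hlin hd (Nat.le_succ _) hρ hl hr hk h2
          exact .inr ⟨t', h1.tail h3, h4⟩
        | arg g vs i u hg hu =>
          simp only [Term.func.injEq] at hs
          obtain ⟨rfl, hs⟩ := hs
          obtain ⟨rfl, rfl⟩ := (by simpa using hs)
          refine .inl ⟨_, rfl, fun j => ?_⟩
          by_cases hj : j = i
          · subst hj; simpa using (hts j).tail hu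
          · simpa [hj] using hts j
      · obtain ⟨t'', h1, h2⟩ := hsim.exists_zeroStep hlin hd hstep
        exact .inr ⟨t'', ht'.tail h1, h2⟩
  obtain ⟨ts, rfl, hts⟩ | ⟨t', ht', hsim⟩ := key
  · obtain ⟨ts', h1, h2⟩ := lift ts hts
    exact ⟨_, h1, (cut_eq_of_le (Nat.le_succ _) h2).symm⟩
  · exact ⟨t', ht', (hsim _).symm⟩

variable (L D) in
/-- The terms of depth at most `n` with marks at most `k`. -/
def boundedTerms (k : ℕ) : ℕ → Set ((marked L).Term D)
  | 0 => Set.range .var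
  | n + 1 => Set.range .var ∪ ⋃ p : (Σ m, L.Functions m) × Fin (k + 1),
      (fun ts => Term.func (withMark p.1.2 p.2) ts) '' Set.pi Set.univ fun _ => boundedTerms k n

theorem finite_boundedTerms {E : Type w} [Finite (Σ n, L.Functions n)] [Finite E] (k n : ℕ) :
    (boundedTerms L E k n).Finite := by
  induction n with
  | zero => exact Set.finite_range _
  | succ n ih =>
    exact (Set.finite_range _).union
      (Set.finite_iUnion fun p => (Set.Finite.pi fun _ => ih).image _)

theorem cut_mem_boundedTerms {d k n b : ℕ} (hb : b ≤ n) {t : (marked L).Term Empty}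
    (ht : maxMark t ≤ k) : cut D d k b t ∈ boundedTerms L D k n := by
  induction t generalizing n b with
  | var x => exact x.elim
  | func f ts ih =>
    rw [maxMark_func_le] at ht
    cases b with
    | zero => cases n <;> simp [cut, boundedTerms]
    | succ b =>
      obtain ⟨n, rfl⟩ : ∃ c, n = c + 1 := ⟨n - 1, by omega⟩
      -- Positive marks only reduce the number of visible levels.
      refine .inr (Set.mem_iUnion.2 ⟨⟨⟨_, symBase f⟩, ⟨symMark f, by omega⟩⟩, _, ?_, rfl⟩)
      intro i _
      refine ih i ?_ (ht.2 i)
      have : visible d k (symMark f) b ≤ visible d k 0 b := visible_mono (Nat.zero_le _) le_rfl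
      simp only [visible, if_true] at this
      simp only [visible]
      omega

theorem finite_range_profile [Finite (Σ n, L.Functions n)] [Finite D] (R : Set (Rule L))
    (d k : ℕ) : (Set.range (profile D R d k)).Finite := by
  refine (finite_boundedTerms (L := L) (E := D) k ((k + 1) * (d + 1))).finite_subsets.subset ?_
  rintro _ ⟨s, rfl⟩ _ ⟨t, ht, rfl⟩
  exact cut_mem_boundedTerms le_rfl (maxMark_le_of_zeroSteps ht)

end Profiles

/-! ### Recognizability -/

section Recognizability

variable {L : FirstOrder.Language.{u, v}}

/-- The Myhill–Nerode criterion: a set is recognizable if it is saturated by a map with finite range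
whose kernel is a congruence. -/
theorem recognizable_of_finite_range {X : Type*} (c : L.Term Empty → X)
    (hfin : (Set.range c).Finite)
    (hc : ∀ (n : ℕ) (f : L.Functions n) (ss ts : Fin n → L.Term Empty),
      (∀ i, c (ss i) = c (ts i)) → c (.func f ss) = c (.func f ts))
    {T : Set (L.Term Empty)} (hT : ∀ s t, c s = c t → s ∈ T → t ∈ T) : Recognizable T := by
  have := hfin.to_subtype
  obtain ⟨N, ⟨e⟩⟩ := Finite.exists_equiv_fin (Set.range c)
  let code : L.Term Empty → Fin N := fun t => e ⟨c t, t, rfl⟩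
  have hcode : ∀ s t, code s = code t ↔ c s = c t := fun s t =>
    e.injective.eq_iff.trans Subtype.mk_eq_mk
  -- The classes are the states; a transition exists if some representatives realize it.
  let A : TreeAutomaton L (Fin N) :=
    { trans := fun f qs => {q | ∃ ts, (∀ i, code (ts i) = qs i) ∧ code (.func f ts) = q}
      final := code '' T }
  have h1 : ∀ t q, A.Reaches t q → code t = q := by
    intro t q h
    induction h with
    | node f ts qs q _ hq ih =>
      obtain ⟨us, hus, rfl⟩ := hq
      exact (hcode _ _).2 (hc _ f _ _ fun i => (hcode _ _).1 ((ih i).trans (hus i).symm))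
  have h2 : ∀ t, A.Reaches t (code t) := by
    intro t
    induction t with
    | var x => exact x.elim
    | func f ts ih => exact .node f ts (fun i => code (ts i)) _ ih ⟨ts, fun _ => rfl, rfl⟩
  refine ⟨Fin N, inferInstance, A, Set.ext fun t => ⟨?_, fun ht => ⟨_, ⟨t, ht, rfl⟩, h2 t⟩⟩⟩
  rintro ⟨_, ⟨s, hs, rfl⟩, h⟩
  exact hT s t ((hcode s t).1 (h1 t _ h).symm) hs

/-- The algebra of the sets of states of a tree automaton, the result of its determinization. -/
@[reducible] def TreeAutomaton.powersetStructure {Q : Type} (A : TreeAutomaton L Q) :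
    L.Structure (Set Q) where
  funMap f S := {q | ∃ qs, (∀ i, qs i ∈ S i) ∧ q ∈ A.trans f qs}
  RelMap _ _ := False

theorem TreeAutomaton.mem_realize_iff {Q : Type} (A : TreeAutomaton L Q) (t : L.Term Empty)
    (q : Q) :
    q ∈ (letI := A.powersetStructure; t.realize (Empty.elim : Empty → Set Q)) ↔ A.Reaches t q := by
  let _ := A.powersetStructure
  induction t generalizing q with
  | var x => exact x.elim
  | func f ts ih =>
    constructor
    · rintro ⟨qs, hqs, hq⟩
      exact .node f ts qs q (fun i => (ih i _).1 (hqs i)) hq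
    · intro h
      cases h with
      | node _ _ qs _ h hq => exact ⟨qs, fun i => (ih i _).2 (h i), hq⟩

/-- No assumption on `R` but finiteness and linearity is needed for the ancestors with respect to
bottom-up(`k`) derivations. -/
theorem recognizable_ancestors_buDerives [Finite (Σ n, L.Functions n)] {R : Set (Rule L)}
    (hfin : R.Finite) (hlin : LinearSystem R) (k : ℕ) {T : Set (L.Term Empty)}
    (hT : Recognizable T) : Recognizable (ancestors (BUDerives R k) T) := by
  obtain ⟨Q, _, A, rfl⟩ := hT
  let _ := A.powersetStructure
  obtain ⟨d, hd⟩ : ∃ d, ∀ ρ ∈ R, depth ρ.lhs ≤ d := by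
    obtain ⟨d, hd⟩ := (hfin.image fun ρ => depth ρ.lhs).bddAbove
    exact ⟨d, fun ρ hρ => hd ⟨ρ, hρ, rfl⟩⟩
  refine recognizable_of_finite_range (profile (Set Q) R d k) (finite_range_profile R d k) ?_ ?_
  · intro n f ss ts h
    exact (profile_func_subset hlin hd f fun i => (h i).subset).antisymm
      (profile_func_subset hlin hd f fun i => (h i).superset)
  · rintro s s' h ⟨_, ⟨q, hq, hr⟩, t, ht, rfl⟩
    have hmem : cut (Set Q) d k ((k + 1) * (d + 1)) t ∈ profile (Set Q) R d k s' :=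
      h ▸ ⟨t, buMarkedSteps_iff_zeroSteps.1 ht, rfl⟩
    obtain ⟨t', ht', e⟩ := hmem
    refine ⟨unmark t', ⟨q, hq, ?_⟩, t', buMarkedSteps_iff_zeroSteps.2 ht', rfl⟩
    rw [← A.mem_realize_iff] at hr ⊢
    have := val_eq_of_cut_eq e
    rw [val, val] at this
    rwa [this]

end Recognizability

end BottomUp

theorem mainTheorem2 {L : FirstOrder.Language} [Finite (Σ n, L.Functions n)]
    (R : Set (BottomUp.Rule L)) (hfin : R.Finite) (hlin : BottomUp.LinearSystem R) :
    (BottomUp.IsBU R → BottomUp.InverseRecognizabilityPreserving R) ∧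
    (∀ k : ℕ, BottomUp.IsBUk R k →
      (∀ T : Set (L.Term Empty),
        BottomUp.ancestors (BottomUp.Derives R) T =
          BottomUp.ancestors (BottomUp.BUDerives R k) T) ∧
      (∀ T : Set (L.Term Empty), BottomUp.Recognizable T →
        BottomUp.Recognizable (BottomUp.ancestors (BottomUp.BUDerives R k) T))) := by
  have heq : ∀ k, BottomUp.IsBUk R k → BottomUp.Derives R = BottomUp.BUDerives R k :=
    fun k hk => funext₂ fun s t => propext ⟨hk s t, BottomUp.BUDerives.derives⟩
  refine ⟨fun ⟨k, hk⟩ T hT => ?_, fun k hk => ⟨fun T => by rw [heq k hk], fun T hT => ?_⟩⟩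
  · rw [heq k hk]
    exact BottomUp.recognizable_ancestors_buDerives hfin hlin k hT
  · exact BottomUp.recognizable_ancestors_buDerives hfin hlin k hT
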